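/- For integers $r, q \ge 1$ let $B_q^{(r)} = K_r + qK_1$ denote the generalized book, i.e. the graph consisting of $q$ pairwise non-adjacent vertices each joined to every vertex of an $r$-clique. For finite graphs $H_1, H_2$ let $r(H_1,H_2)$ denote the Ramsey number, i.e. the least $n$ such that for every graph $G$ of order $n$ either $H_1$ is a (not necessarily induced) subgraph of $G$ or $H_2$ is a subgraph of the complement $\overline{G}$. Theorem. Let $p$ be a non-negative integer. For every fixed finite graph $H$ with chromatic number exactly $p+1$ and every fixed integer $r>1$, $$r\left(H, B_q^{(r)}\right) = pq + o(q) \qquad (q\to\infty),$$ that is, $\lim_{q\to\infty} \bigl(r(H,B_q^{(r)}) - pq\bigr)/q = 0$. -/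

import Mathlib

open Filter Asymptotics

/-- The generalized book `B_q^{(r)} = K_r + q K_1`, the join of a clique on `Fin r` (the base) with
`q` independent vertices `Fin q` (the pages): distinct vertices are adjacent unless both are
pages. -/
def generalizedBook (r q : ℕ) : SimpleGraph (Fin r ⊕ Fin q) where
  Adj x y := x ≠ y ∧ (x.isLeft ∨ y.isLeft)
  symm := ⟨fun _ _ h => ⟨h.1.symm, h.2.symm⟩⟩
  loopless := ⟨fun _ h => h.1 rfl⟩

/-- The arrow relation `n → (H₁, H₂)`: every graph `G` of order `n` contains `H₁` as a (not
necessarily induced) subgraph, or its complement contains `H₂`. -/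
def RamseyArrow {V W : Type*} (H₁ : SimpleGraph V) (H₂ : SimpleGraph W) (n : ℕ) : Prop :=
  ∀ G : SimpleGraph (Fin n), H₁.IsContained G ∨ H₂.IsContained Gᶜ

/-- The Ramsey number `r(H₁, H₂)`: the least `n` such that `n → (H₁, H₂)`. The set is nonempty
for finite graphs, see `ramseyArrow_ramseyNumber`. -/
noncomputable def ramseyNumber {V W : Type*} (H₁ : SimpleGraph V) (H₂ : SimpleGraph W) : ℕ :=
  sInf {n | RamseyArrow H₁ H₂ n}

/-- Ramsey's theorem for cliques inside a large vertex set. -/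
theorem exists_clique_or_compl_clique (a b : ℕ) :
    ∃ N : ℕ, ∀ {α : Type} [DecidableEq α] (G : SimpleGraph α) (s : Finset α), N ≤ s.card →
      (∃ t ⊆ s, G.IsNClique a t) ∨ (∃ t ⊆ s, Gᶜ.IsNClique b t) := by
  classical
  induction a generalizing b with
  | zero => exact ⟨0, fun G s _ => Or.inl ⟨∅, by simp, by simp⟩⟩
  | succ a iha =>
    induction b with
    | zero => exact ⟨0, fun G s _ => Or.inr ⟨∅, by simp, by simp⟩⟩
    | succ b ihb =>
      obtain ⟨N₁, h₁⟩ := iha (b + 1)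
      obtain ⟨N₂, h₂⟩ := ihb
      refine ⟨N₁ + N₂ + 1, fun {α} _ G s hs => ?_⟩
      obtain ⟨v, hv⟩ : s.Nonempty := Finset.card_pos.mp (by omega)
      have hc := Finset.card_filter_add_card_filter_not (s := s.erase v) (fun w => G.Adj v w)
      rw [Finset.card_erase_of_mem hv] at hc
      have hsub : ∀ (P : α → Prop) [DecidablePred P], (s.erase v).filter P ⊆ s :=
        fun P _ => (Finset.filter_subset _ _).trans (Finset.erase_subset _ _)
      by_cases hN : N₁ ≤ ((s.erase v).filter (fun w => G.Adj v w)).card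
      · rcases h₁ G _ hN with ⟨t, ht, hq⟩ | ⟨t, ht, hq⟩
        · refine Or.inl ⟨insert v t, ?_, hq.insert fun w hw => ?_⟩
          · exact Finset.insert_subset hv (ht.trans (hsub _))
          · exact (Finset.mem_filter.mp (ht hw)).2
        · exact Or.inr ⟨t, ht.trans (hsub _), hq⟩
      · rcases h₂ G ((s.erase v).filter (fun w => ¬ G.Adj v w)) (by omega) with
          ⟨t, ht, hq⟩ | ⟨t, ht, hq⟩
        · exact Or.inl ⟨t, ht.trans (hsub _), hq⟩
        · refine Or.inr ⟨insert v t, ?_, hq.insert fun w hw => ?_⟩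
          · exact Finset.insert_subset hv (ht.trans (hsub _))
          · have hw' := Finset.mem_filter.mp (ht hw)
            exact (SimpleGraph.compl_adj _ _ _).mpr
              ⟨(Finset.ne_of_mem_erase hw'.1).symm, hw'.2⟩

/-- A graph with a clique of size `|V|` contains every graph on `V`. -/
theorem isContained_of_isNClique {V α : Type*} [Fintype V] (H : SimpleGraph V)
    (G : SimpleGraph α) (t : Finset α) (ht : G.IsNClique (Fintype.card V) t) :
    H.IsContained G := by
  have e : V ≃ t := Fintype.equivOfCardEq (by simp [ht.card_eq])
  refine ⟨⟨⟨fun v => (e v : α), fun {x y} hxy => ?_⟩, fun x y hxy => ?_⟩⟩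
  · exact ht.isClique (e x).2 (e y).2 (fun h => hxy.ne (e.injective (Subtype.ext h)))
  · exact e.injective (Subtype.ext hxy)

/-- For finite graphs the Ramsey number is attained, so it never takes the default value of
`sInf`. -/
theorem ramseyArrow_ramseyNumber {V W : Type*} [Finite V] [Finite W]
    (H₁ : SimpleGraph V) (H₂ : SimpleGraph W) :
    RamseyArrow H₁ H₂ (ramseyNumber H₁ H₂) := by
  cases nonempty_fintype V
  cases nonempty_fintype W
  refine Nat.sInf_mem (s := {n | RamseyArrow H₁ H₂ n}) ?_
  obtain ⟨N, hN⟩ := exists_clique_or_compl_clique (Fintype.card V) (Fintype.card W)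
  refine ⟨N, fun G => ?_⟩
  rcases hN G Finset.univ (by simp) with ⟨t, -, ht⟩ | ⟨t, -, ht⟩
  · exact Or.inl (isContained_of_isNClique H₁ G t ht)
  · exact Or.inr (isContained_of_isNClique H₂ Gᶜ t ht)

/-! The lower bound comes from a complete `p`-partite graph. For the upper bound, a graph with no
copy of `H` has no clique of size `|V|`; if its complement also has no book,
`exists_joined_independent_sets` builds `p + 1` pairwise joined independent sets one at a time, and
these contain `H`. Given `j ≤ p` such sets, each cut into `r`-blocks, at most `q + r` vertices miss
a given block, so little more than `q` vertices have few neighbours in a given set. More than `pq`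
vertices therefore leave many with `t` neighbours in every set; pigeonhole makes these
neighbourhoods agree, and Ramsey's theorem supplies the next set. -/

/-- A clique `S` of size `r` together with `q` further common neighbours of `S` yields a copy of
the generalized book. -/
theorem generalizedBook_isContained {α : Type*} (G : SimpleGraph α) {r q : ℕ} {S T : Finset α}
    (hS : G.IsNClique r S) (hT : q ≤ T.card) (hST : ∀ s ∈ S, ∀ v ∈ T, G.Adj s v) :
    (generalizedBook r q).IsContained G := by
  obtain ⟨T', hT', hc⟩ := Finset.exists_subset_card_eq hT
  have e : Fin r ≃ S := Fintype.equivOfCardEq (by simp [hS.card_eq])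
  have e' : Fin q ≃ T' := Fintype.equivOfCardEq (by simp [hc])
  have hadj : ∀ i j, G.Adj (e i) (e' j) := fun i j => hST _ (e i).2 _ (hT' (e' j).2)
  refine ⟨⟨⟨Sum.elim (fun i => (e i : α)) (fun j => (e' j : α)), ?_⟩, ?_⟩⟩
  · rintro (i | i) (j | j) ⟨hne, hl⟩
    · exact hS.isClique (e i).2 (e j).2 fun h =>
        hne (congrArg Sum.inl (e.injective (Subtype.ext h)))
    · exact hadj i j
    · exact (hadj j i).symm
    · simp at hl
  · rintro (i | i) (j | j) h
    · exact congrArg Sum.inl (e.injective (Subtype.ext h))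
    · exact absurd h (hadj i j).ne
    · exact absurd h (hadj j i).ne'
    · exact congrArg Sum.inr (e'.injective (Subtype.ext h))

/-- A graph properly coloured with `k` colours is contained in every graph that has `k` pairwise
completely joined vertex sets of the size of its vertex set. -/
theorem isContained_of_coloring {V α : Type*} [Fintype V] {H : SimpleGraph V} {G : SimpleGraph α}
    {k : ℕ} (c : H.Coloring (Fin k)) (A : Fin k → Finset α)
    (hA : ∀ i, (A i).card = Fintype.card V)
    (hadj : ∀ i j, i ≠ j → ∀ a ∈ A i, ∀ b ∈ A j, G.Adj a b) : H.IsContained G := by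
  have e : ∀ i, V ≃ A i := fun i => Fintype.equivOfCardEq (by simp [hA])
  refine ⟨⟨⟨fun v => (e (c v) v : α), fun {x y} hxy =>
    hadj _ _ (c.valid hxy) _ (e _ x).2 _ (e _ y).2⟩, fun x y hxy => ?_⟩⟩
  change (e (c x) x : α) = (e (c y) y : α) at hxy
  by_cases h : c x = c y
  · rw [h] at hxy
    exact (e _).injective (Subtype.ext hxy)
  · exact absurd hxy (hadj _ _ h _ (e _ x).2 _ (e _ y).2).ne

/-- In a graph whose complement has no book, few vertices have fewer than `t` neighbours in an
independent set of size `m * r`. -/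
theorem card_few_neighbors_mul_le {n r q m t : ℕ} (G : SimpleGraph (Fin n)) [DecidableRel G.Adj]
    (hB : ¬ (generalizedBook r q).IsContained Gᶜ) {A : Finset (Fin n)}
    (hA : Gᶜ.IsNClique (m * r) A) :
    (Finset.univ.filter fun v => (A.filter (G.Adj v)).card < t).card * (m - t)
      ≤ m * (q + r) := by
  classical
  have e : Fin m × Fin r ≃ A := Fintype.equivOfCardEq (by simp [hA.card_eq])
  let S : Fin m → Finset (Fin n) := fun b => Finset.univ.image fun i => (e (b, i) : Fin n)
  have hScard : ∀ b, (S b).card = r := fun b => by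
    rw [Finset.card_image_of_injective]
    · simp
    · intro i j hij
      simpa using e.injective (Subtype.ext hij)
  have hSA : ∀ b, S b ⊆ A := fun b x hx => by
    obtain ⟨i, -, rfl⟩ := Finset.mem_image.mp hx
    exact (e _).2
  -- The extra `r` pays for the block itself, whose vertices are counted here but cannot be pages.
  have key : ∀ b, (Finset.univ.filter fun v => ∀ s ∈ S b, ¬ G.Adj v s).card ≤ q + r := by
    intro b
    by_contra! hlt
    refine hB (generalizedBook_isContained Gᶜ (S := S b)
      (T := (Finset.univ.filter fun v => ∀ s ∈ S b, ¬ G.Adj v s) \ S b)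
      ⟨hA.isClique.subset (by exact_mod_cast hSA b), hScard b⟩ ?_ ?_)
    · have := Finset.le_card_sdiff (S b) (Finset.univ.filter fun v => ∀ s ∈ S b, ¬ G.Adj v s)
      rw [hScard] at this
      omega
    · intro s hs v hv
      simp only [Finset.mem_sdiff, Finset.mem_filter, Finset.mem_univ, true_and] at hv
      exact (SimpleGraph.compl_adj _ _ _).mpr
        ⟨fun h => hv.2 (h ▸ hs), fun h => hv.1 s hs h.symm⟩
  have h := Finset.card_mul_le_card_mul (s := Finset.univ.filter
      fun v => (A.filter (G.Adj v)).card < t) (t := (Finset.univ : Finset (Fin m)))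
      (m := m - t) (n := q + r) (fun v b => ∀ s ∈ S b, ¬ G.Adj v s) ?_ ?_
  · simpa using h
  · intro v hv
    have hv' := (Finset.mem_filter.mp hv).2
    rw [Finset.bipartiteAbove]
    have hc := Finset.card_filter_add_card_filter_not (s := (Finset.univ : Finset (Fin m)))
      (fun b => ∀ s ∈ S b, ¬ G.Adj v s)
    rw [Finset.card_univ, Fintype.card_fin] at hc
    -- Blocks are disjoint, so distinct blocks that are hit contain distinct neighbours of `v`.
    have hle : (Finset.univ.filter fun b => ¬ ∀ s ∈ S b, ¬ G.Adj v s).card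
        ≤ (A.filter (G.Adj v)).card := by
      refine Finset.card_le_card_of_forall_subsingleton (fun b x => x ∈ S b) ?_ ?_
      · intro b hb
        obtain ⟨x, hx, hvx⟩ : ∃ x ∈ S b, G.Adj v x := by simpa using hb
        exact ⟨x, Finset.mem_filter.mpr ⟨hSA b hx, hvx⟩, hx⟩
      · rintro x - b ⟨-, hb⟩ b' ⟨-, hb'⟩
        obtain ⟨i, -, hi⟩ := Finset.mem_image.mp hb
        obtain ⟨j, -, hj⟩ := Finset.mem_image.mp hb'
        exact congrArg Prod.fst (e.injective (Subtype.ext (hi.trans hj.symm)))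
    omega
  · intro b _
    refine (Finset.card_le_card fun v hv => ?_).trans (key b)
    simp only [Finset.bipartiteBelow, Finset.mem_filter] at hv
    simpa using hv.2

/-- If a graph on `n ≥ (p + ε) q` vertices, `q` large, has no large clique and its complement has
no book with `q` pages, then the graph contains `j ≤ p + 1` pairwise completely joined independent
sets of any prescribed size. -/
theorem exists_joined_independent_sets (p h : ℕ) {r : ℕ} (hr : 0 < r) {ε : ℝ} (hε : 0 < ε) (j : ℕ) (hj : j ≤ p + 1)
    (t : ℕ) : ∃ Q : ℕ, ∀ q n : ℕ, Q ≤ q → (p + ε) * q ≤ n → ∀ G : SimpleGraph (Fin n),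
      (∀ s, ¬ G.IsNClique h s) → ¬ (generalizedBook r q).IsContained Gᶜ →
      ∃ A : Fin j → Finset (Fin n), (∀ i, Gᶜ.IsNClique t (A i)) ∧
        ∀ i k, i ≠ k → ∀ a ∈ A i, ∀ b ∈ A k, G.Adj a b := by
  classical
  induction j generalizing t with
  | zero => exact ⟨0, fun q n _ _ G _ _ => ⟨Fin.elim0, fun i => i.elim0, fun i => i.elim0⟩⟩
  | succ j ih =>
    obtain ⟨M, hM⟩ := exists_clique_or_compl_clique h t
    -- Chosen so that `p (1 + t / k) ≤ p + ε / 2`.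
    obtain ⟨k, hk⟩ := exists_nat_gt (2 * p * t / ε)
    have hk0 : 0 < (k : ℝ) := lt_of_le_of_lt (by positivity) hk
    let m := t + k
    obtain ⟨Q, hQ⟩ := ih (by omega) (m * r)
    let C := (m * r).choose t ^ j
    -- Ensures `(p + ε) q - (p + ε / 2) (q + r) ≥ C M`.
    obtain ⟨Q', hQ'⟩ := exists_nat_gt ((C * M + (p + ε / 2) * r) / (ε / 2))
    refine ⟨max Q Q', fun q n hq hn G hG hB => ?_⟩
    obtain ⟨A, hA, hadj⟩ := hQ q n (le_trans (le_max_left _ _) hq) hn G hG hB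
    let bad : Fin j → Finset (Fin n) := fun i =>
      Finset.univ.filter fun v => ((A i).filter (G.Adj v)).card < t
    have hbad : ∀ i, (p : ℝ) * (bad i).card ≤ (p + ε / 2) * (q + r) := by
      intro i
      have h1 : (bad i).card * (m - t) ≤ m * (q + r) :=
        card_few_neighbors_mul_le G hB (hA i)
      rw [show m - t = k by omega] at h1
      have h2 : ((bad i).card : ℝ) * k ≤ (t + k) * (q + r) := by exact_mod_cast h1
      have h3 : (p : ℝ) * t ≤ ε / 2 * k := by
        rw [div_lt_iff₀ hε] at hk
        linarith
      refine le_of_mul_le_mul_right ?_ hk0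
      calc (p : ℝ) * (bad i).card * k = p * ((bad i).card * k) := by ring
        _ ≤ p * ((t + k) * (q + r)) := by gcongr
        _ = (p * t + p * k) * (q + r) := by ring
        _ ≤ (ε / 2 * k + p * k) * (q + r) := by gcongr
        _ = (p + ε / 2) * (q + r) * k := by ring
    let good : Finset (Fin n) := Finset.univ \ Finset.univ.biUnion bad
    have hsum : ((Finset.univ.biUnion bad).card : ℝ) ≤ (p + ε / 2) * (q + r) := by
      rcases Nat.eq_zero_or_pos j with rfl | hj0
      · simp only [Finset.univ_eq_empty, Finset.biUnion_empty, Finset.card_empty, Nat.cast_zero]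
        positivity
      have hp0 : 0 < (p : ℝ) := by exact_mod_cast (by omega : 0 < p)
      have hjp : (j : ℝ) ≤ p := by exact_mod_cast (by omega : j ≤ p)
      have h1 : ((Finset.univ.biUnion bad).card : ℝ) ≤ ∑ i, ((bad i).card : ℝ) := by
        exact_mod_cast Finset.card_biUnion_le
      have h2 : ∑ i, (p : ℝ) * (bad i).card ≤ j * ((p + ε / 2) * (q + r)) := by
        simpa using Finset.sum_le_sum fun i (_ : i ∈ Finset.univ) => hbad i
      rw [← Finset.mul_sum] at h2
      refine le_of_mul_le_mul_left ((mul_le_mul_of_nonneg_left h1 hp0.le).trans (h2.trans ?_)) hp0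
      gcongr
    have hgood : C * M ≤ good.card := by
      have h1 : n - (Finset.univ.biUnion bad).card ≤ good.card := by
        simpa using Finset.le_card_sdiff (Finset.univ.biUnion bad) (Finset.univ : Finset (Fin n))
      have h2 : (n : ℝ) ≤ (Finset.univ.biUnion bad).card + good.card := by
        exact_mod_cast (by omega : n ≤ (Finset.univ.biUnion bad).card + good.card)
      have h3 : (Q' : ℝ) ≤ q := by exact_mod_cast le_trans (le_max_right _ _) hq
      have h4 := hQ'.trans_le h3
      rw [div_lt_iff₀ (by positivity)] at h4
      have : ((C * M : ℕ) : ℝ) ≤ good.card := by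
        push_cast
        nlinarith
      exact_mod_cast this
    have hsub : ∀ v ∈ good, ∀ i, ∃ B ⊆ (A i).filter (G.Adj v), B.card = t := by
      intro v hv i
      refine Finset.exists_subset_card_eq ?_
      by_contra! hlt
      exact (Finset.mem_sdiff.mp hv).2 (Finset.mem_biUnion.mpr
        ⟨i, Finset.mem_univ _, Finset.mem_filter.mpr ⟨Finset.mem_univ _, hlt⟩⟩)
    choose! B hBsub hBcard using hsub
    -- Pigeonhole over the `C` possible tuples of `t`-subsets.
    have hmaps : ∀ v ∈ good, B v ∈ Fintype.piFinset fun i => (A i).powersetCard t := by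
      intro v hv
      refine Fintype.mem_piFinset.mpr fun i => Finset.mem_powersetCard.mpr
        ⟨(hBsub v hv i).trans (Finset.filter_subset _ _), hBcard v hv i⟩
    have hcardC : (Fintype.piFinset fun i => (A i).powersetCard t).card = C := by
      simp [Fintype.card_piFinset, Finset.card_powersetCard, (hA _).card_eq, C]
    have hne : (Fintype.piFinset fun i => (A i).powersetCard t).Nonempty := by
      refine Fintype.piFinset_nonempty.mpr fun i => Finset.powersetCard_nonempty.mpr ?_
      rw [(hA i).card_eq]
      exact (Nat.le_add_right t k).trans (Nat.le_mul_of_pos_right m hr)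
    obtain ⟨D, hD, hDM⟩ := Finset.exists_le_card_fiber_of_mul_le_card_of_maps_to hmaps
      hne (by rw [hcardC]; exact hgood)
    obtain ⟨s, -, hs⟩ | ⟨I, hI, hIc⟩ := hM G _ hDM
    · exact absurd hs (hG s)
    have hDI : ∀ v ∈ I, ∀ i, ∀ b ∈ D i, G.Adj v b := by
      intro v hv i b hb
      obtain ⟨hvg, rfl⟩ := Finset.mem_filter.mp (hI hv)
      exact (Finset.mem_filter.mp (hBsub v hvg i hb)).2
    have hDA : ∀ i, D i ⊆ A i ∧ (D i).card = t := fun i =>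
      Finset.mem_powersetCard.mp (Fintype.mem_piFinset.mp hD i)
    refine ⟨Fin.cons I D, fun i => ?_, fun i k => ?_⟩
    · refine Fin.cases hIc (fun i => ?_) i
      exact ⟨(hA i).isClique.subset (by exact_mod_cast (hDA i).1), (hDA i).2⟩
    · refine Fin.cases ?_ (fun i => ?_) i <;> refine Fin.cases ?_ (fun k => ?_) k
      · exact fun hne => absurd rfl hne
      · exact fun _ a ha b hb => hDI a ha k b hb
      · exact fun _ a ha b hb => (hDI b hb i a ha).symm
      · exact fun hne a ha b hb => hadj i k (fun h => hne (congrArg Fin.succ h)) a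
          ((hDA i).1 ha) b ((hDA k).1 hb)

/-- The lower bound, from the complete `p`-partite graph with parts of size at most `q`. -/
theorem mul_le_ramseyNumber {V : Type*} [Finite V] {H : SimpleGraph V} {p r : ℕ}
    (hH : ¬ H.Colorable p) (hr : 0 < r) (q : ℕ) :
    p * q ≤ ramseyNumber H (generalizedBook r q) := by
  classical
  by_contra! hlt
  set N := ramseyNumber H (generalizedBook r q) with hN
  have hq : 0 < q := Nat.pos_of_mul_pos_left (Nat.zero_lt_of_lt hlt)
  let c : Fin N → Fin p := fun a =>
    ⟨a / q, (Nat.div_lt_iff_lt_mul hq).mpr (a.2.trans hlt)⟩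
  let G : SimpleGraph (Fin N) := (⊤ : SimpleGraph (Fin p)).comap c
  rcases ramseyArrow_ramseyNumber H (generalizedBook r q) G with ⟨⟨f⟩⟩ | ⟨⟨f⟩⟩
  · exact hH ⟨SimpleGraph.Coloring.mk (fun v => c (f.toHom v)) fun hvw => f.toHom.map_adj hvw⟩
  · let x₀ : Fin r ⊕ Fin q := Sum.inl ⟨0, hr⟩
    -- Every other book vertex is adjacent to `x₀`, so the whole book lies in one part, which has at
    -- most `q < r + q` vertices.
    have hc : ∀ x, ((f.toHom x : Fin N) : ℕ) / q = ((f.toHom x₀ : Fin N) : ℕ) / q := by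
      intro x
      by_cases hx : x = x₀
      · rw [hx]
      · have h : (generalizedBook r q).Adj x x₀ := ⟨hx, Or.inr rfl⟩
        have h' := ((SimpleGraph.compl_adj _ _ _).mp (f.toHom.map_adj h)).2
        have h'' : c (f.toHom x) = c (f.toHom x₀) := by
          by_contra hne
          exact h' hne
        exact congrArg Fin.val h''
    have hinj : Function.Injective fun x =>
        (⟨((f.toHom x : Fin N) : ℕ) % q, Nat.mod_lt _ hq⟩ : Fin q) := by
      intro x y hxy
      apply f.injective
      apply Fin.ext
      have h1 := congrArg Fin.val hxy
      change ((f.toHom x : Fin N) : ℕ) % q = ((f.toHom y : Fin N) : ℕ) % q at h1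
      change ((f.toHom x : Fin N) : ℕ) = ((f.toHom y : Fin N) : ℕ)
      rw [← Nat.div_add_mod (f.toHom x : ℕ) q, ← Nat.div_add_mod (f.toHom y : ℕ) q, hc x, hc y, h1]
    have := Fintype.card_le_of_injective _ hinj
    simp at this
    omega

theorem mainTheorem5 {V : Type*} [Finite V] (H : SimpleGraph V) (p r : ℕ)
    (hH : H.chromaticNumber = ((p + 1 : ℕ) : ℕ∞)) (hr : 1 < r) :
    (fun q : ℕ => (ramseyNumber H (generalizedBook r q) : ℝ) - (p : ℝ) * (q : ℝ))
      =o[atTop] (fun q : ℕ => (q : ℝ)) := by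
  cases nonempty_fintype V
  have hcol : H.Colorable (p + 1) := SimpleGraph.chromaticNumber_le_iff_colorable.mp hH.le
  have hncol : ¬ H.Colorable p := fun h => by
    have := hH ▸ SimpleGraph.chromaticNumber_le_iff_colorable.mpr h
    exact absurd (ENat.natCast_le_natCast.mp this) (by omega)
  obtain ⟨col⟩ := hcol
  rw [isLittleO_iff]
  intro ε hε
  obtain ⟨Q, hQ⟩ := exists_joined_independent_sets p (Fintype.card V) (by omega : 0 < r) (half_pos hε) (p + 1)
    le_rfl (Fintype.card V)
  -- Lets `ε q / 2` absorb the `1` lost to the ceiling.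
  obtain ⟨Q', hQ'⟩ := exists_nat_gt (2 / ε)
  filter_upwards [eventually_ge_atTop (max Q Q')] with q hq
  have hlow : (p : ℝ) * q ≤ ramseyNumber H (generalizedBook r q) := by
    exact_mod_cast mul_le_ramseyNumber hncol (by omega : 0 < r) q
  have hup : ramseyNumber H (generalizedBook r q) ≤ ⌈(p + ε / 2) * (q : ℝ)⌉₊ := by
    refine Nat.sInf_le fun G => ?_
    by_contra hcon
    rw [not_or] at hcon
    obtain ⟨A, hA, hadj⟩ := hQ q _ (le_trans (le_max_left _ _) hq) (Nat.le_ceil _) G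
      (fun s hs => hcon.1 (isContained_of_isNClique H G s hs)) hcon.2
    exact hcon.1 (isContained_of_coloring col A (fun i => (hA i).card_eq) hadj)
  have hup' : (ramseyNumber H (generalizedBook r q) : ℝ) < (p + ε / 2) * q + 1 :=
    lt_of_le_of_lt (by exact_mod_cast hup) (Nat.ceil_lt_add_one (by positivity))
  have hqq : (Q' : ℝ) ≤ q := by exact_mod_cast le_trans (le_max_right _ _) hq
  have h2 := hQ'.trans_le hqq
  rw [div_lt_iff₀ hε] at h2
  rw [Real.norm_of_nonneg (by linarith), Real.norm_of_nonneg (by positivity)]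
  nlinarith
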